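/- **Setting.** Let $G=(X,E)$ be a finite connected simple graph with at least one edge, and let $A$ be its set of arcs (each edge gives two mutually inverse arcs $e,\bar e$; $o(e)$ and $t(e)$ are the origin and the terminus of $e$). A rotation system $(G,\rho,\tau)$ consists of a permutation $\rho$ of $A$ that permutes, for each vertex $x$, the arcs with terminus $x$ in one cycle, and a map $\tau:A\to\mathbb Z_2$ with $\tau(e)=\tau(\bar e)$. **Faces.** Tracing a face means moving from a state $(e,s)\in A\times\mathbb Z_2$ to the state $(e',s+\tau(e'))$, where $e'$ is the inverse arc of $\rho(e)$ if $s=0$ and the inverse arc of $\rho^{-1}(e)$ if $s=1$. A facial walk is a cycle of this permutation of $A\times\mathbb Z_2$. The set $F$ of faces is the set of facial walks, where a facial walk is identified with its inverse (the image of the cycle under $(e,s)\mapsto(\bar e,\,s+\tau(e)+1)$). For $f\in F$, $|f|$ is the length of the cycle, and $f\cap\bar f$ is the set of arcs $e\in A$ such that $f$ traverses both $e$ and $\bar e$; $|f\cap\bar f|$ is the number of these arcs, so that every self-intersecting edge counts twice. **Quantum walk.** Let $A^\tau=A\times\mathbb Z_2$ be the arc set of the double cover $G^\tau$ of $G$ induced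 by $\tau$; here $u=(e,s)$ is the arc from $(o(e),s+\tau(e))$ to $(t(e),s)$, with inverse $\bar u=(\bar e,s+\tau(e))$. Put $\tau(u)=\tau(e)$, and let $\tilde\rho(e,s)=(\rho(e),s)$ if $s=0$ and $\tilde\rho(e,s)=(\rho^{-1}(e),s)$ if $s=1$. Consider the graph with vertices $u\in A^\tau$, with a bridge arc $\beta_u$ from $u$ to $\bar u$ and an island arc from $u$ to $\tilde\rho(u)$ for every $u$, where every island arc is subdivided into two arcs $\xi_u^-,\xi_u^+$ (in this order) by the root of a semi-infinite path (tail) with inward arcs $e_{u,n}$ and outward arcs $\bar e_{u,n}$, $n\ge0$, at distance $n$ from the root. Given a unitary matrix $C=\begin{bmatrix}a&b\\c&d\end{bmatrix}$, the walk evolves by $$\Psi_{t+1}(\beta_u)=(-1)^{\tau(u)}\{c\,\Psi_t(\xi^+_{\tilde\rho^{-1}(u)})+d\,\Psi_t(\beta_{\bar u})\},\qquad \Psi_{t+1}(\xi_u^-)=a\,\Psi_t(\xi^+_{\tilde\rho^{-1}(u)})+b\,\Psi_t(\beta_{\bar u}),$$ $$\Psi_{t+1}(\xi_u^+)=a\,\Psi_t(\xi_u^-)+b\,\Psi_t(e_{u,0}),\qquad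 \Psi_{t+1}(\bar e_{u,0})=c\,\Psi_t(\xi_u^-)+d\,\Psi_t(e_{u,0}),$$ $$\Psi_{t+1}(e_{u,n})=\Psi_t(e_{u,n+1}),\qquad \Psi_{t+1}(\bar e_{u,n+1})=\Psi_t(\bar e_{u,n}).$$ For an inflow $\alpha\in\mathbb C^{A^\tau}$ the initial state is $\Psi_0(e_{u,n})=\alpha(u)$ for all $u,n$, and $\Psi_0=0$ on all other arcs. The stationary state is the pointwise limit $\Psi_\infty=\lim_{t\to\infty}\Psi_t$, and the comfortability is $$\mathcal E=\tfrac12\sum_{u\in A^\tau}\bigl(|\Psi_\infty(\beta_u)|^2+|\Psi_\infty(\xi_u^-)|^2+|\Psi_\infty(\xi_u^+)|^2\bigr).$$ $\mathbb E[\mathcal E]$ is the average of $\mathcal E$ over the inflows $\alpha=\delta_u$, with $u$ uniformly distributed in $A^\tau$. **Statement.** For each $\delta\in(0,1)$ let $C_\delta$ be a unitary matrix as above with $a=1-\delta$, $d\in\mathbb R$ and $-\det C_\delta=1$, and let $\mathcal E_\delta$ be the comfortability of the walk with $C=C_\delta$. Then for every $\delta\in(0,1)$ and every inflow the limit $\Psi_\infty$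 exists at every arc, and $$\lim_{\delta\downarrow0}\delta^2\,\mathbb E[\mathcal E_\delta]=\frac{|F|}{2|E|}\Bigl(1-\frac1{|F|}\sum_{f\in F}\frac{|f\cap\bar f|}{|f|}\Bigr).$$ Equivalently, $\delta^2$ times the average of the square norm $2\mathcal E_\delta$ of the stationary state on the internal graph tends to $\frac{|F|}{|E|}\bigl(1-\frac1{|F|}\sum_{f}\frac{|f\cap\bar f|}{|f|}\bigr)$. -/

import Mathlib

open Filter Topology

/-- A rotation system on a simple graph `G`. The arcs of `G` are its darts, `e.fst` is the origin,
`e.snd` the terminus and `e.symm` the inverse of the arc `e`. The rotation `rot` is a permutation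
of the arcs that cyclically permutes the arcs with a common terminus, and the twist is a
`ZMod 2`-valued function on the (undirected) edges. -/
structure RotationSystem {V : Type*} (G : SimpleGraph V) where
  rot : Equiv.Perm G.Dart
  rot_isCycleOn : ∀ x : V, rot.IsCycleOn {e : G.Dart | e.snd = x}
  twist : G.Dart → ZMod 2
  twist_symm : ∀ e : G.Dart, twist e.symm = twist e

/-- The arcs of the double cover `G^τ`, the graph on `V × ZMod 2` in which `(x, j)` and `(y, k)` are
adjacent iff `x`, `y` are adjacent in `G` and `k = j + τ (x, y)`. The pair `(e, k)` is the arc over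
`e` whose terminus is `(e.snd, k)`; its origin is then `(e.fst, k + τ e)`. -/
abbrev CoverArc {V : Type*} (G : SimpleGraph V) := G.Dart × ZMod 2

namespace RotationSystem

variable {V : Type*} {G : SimpleGraph V} (R : RotationSystem G)

theorem add_add_cancel_two (s t : ZMod 2) : s + t + t = s := by
  rw [add_assoc, CharTwo.add_self_eq_zero, add_zero]

theorem add_one_add_add_one (s t : ZMod 2) : s + t + 1 + t + 1 = s := by
  revert s t; decide

/-- The inverse arc in the double cover. -/
def bar : Equiv.Perm (CoverArc G) where
  toFun u := (u.1.symm, u.2 + R.twist u.1)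
  invFun u := (u.1.symm, u.2 + R.twist u.1)
  left_inv u := by simp [R.twist_symm, add_add_cancel_two]
  right_inv u := by simp [R.twist_symm, add_add_cancel_two]

/-- The rotation `ρ ⊕ ρ⁻¹` of the double cover: `ρ` at the vertices of sheet `0` and `ρ⁻¹` at the
vertices of sheet `1`. -/
def coverRot : Equiv.Perm (CoverArc G) where
  toFun u := (if u.2 = 0 then R.rot u.1 else R.rot.symm u.1, u.2)
  invFun u := (if u.2 = 0 then R.rot.symm u.1 else R.rot u.1, u.2)
  left_inv u := by
    obtain ⟨e, s⟩ := u
    by_cases h : s = 0 <;> simp [h]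
  right_inv u := by
    obtain ⟨e, s⟩ := u
    by_cases h : s = 0 <;> simp [h]

/-! ### Faces -/

/-- One step of the face tracing procedure. A state `(e, s)` records the arc `e` of `G` just
traversed together with the parity `s` of the number of twisted edges traversed so far (including
`e`). The next arc is the inverse of `ρ e` if `s = 0`, and the inverse of `ρ⁻¹ e` if `s = 1`. -/
def faceStep : Equiv.Perm (CoverArc G) := R.coverRot.trans R.bar

/-- Reversal of a traversed arc: the same facial walk run backwards on the opposite sheet. -/
def chiral : Equiv.Perm (CoverArc G) where
  toFun u := (u.1.symm, u.2 + R.twist u.1 + 1)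
  invFun u := (u.1.symm, u.2 + R.twist u.1 + 1)
  left_inv u := by simp [R.twist_symm, add_one_add_add_one]
  right_inv u := by simp [R.twist_symm, add_one_add_add_one]

theorem chiral_chiral (u : CoverArc G) : R.chiral (R.chiral u) = u := R.chiral.left_inv u

theorem chiral_inv : R.chiral⁻¹ = R.chiral := by
  ext1 u
  rw [Equiv.Perm.inv_eq_iff_eq, chiral_chiral]

theorem faceStep_chiral_faceStep (u : CoverArc G) :
    R.faceStep (R.chiral (R.faceStep u)) = R.chiral u := by
  obtain ⟨e, s⟩ := u
  have h3 : ∀ t : ZMod 2, 1 + t + 1 = t := by decide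
  have h4 : ∀ t : ZMod 2, 1 + t + t + 1 = 0 := by decide
  have h01 : s = 0 ∨ s = 1 := by revert s; decide
  rcases h01 with rfl | rfl
  · simp [faceStep, chiral, coverRot, bar, R.twist_symm, CharTwo.add_self_eq_zero, add_comm]
  · simp [faceStep, chiral, coverRot, bar, R.twist_symm, h3, h4]

theorem chiral_conj : R.chiral * R.faceStep * R.chiral⁻¹ = R.faceStep⁻¹ := by
  rw [chiral_inv, eq_inv_iff_mul_eq_one]
  ext1 u
  simp only [Equiv.Perm.mul_apply, Equiv.Perm.one_apply]
  have h := R.faceStep_chiral_faceStep u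
  rw [← chiral_chiral R (R.faceStep (R.chiral (R.faceStep u))), h, chiral_chiral] at *

theorem sameCycle_chiral_iff {u v : CoverArc G} :
    R.faceStep.SameCycle (R.chiral u) (R.chiral v) ↔ R.faceStep.SameCycle u v := by
  have key : ∀ {u v : CoverArc G}, R.faceStep.SameCycle u v →
      R.faceStep.SameCycle (R.chiral u) (R.chiral v) := by
    intro u v h
    have h1 := h.conj (g := R.chiral)
    rwa [R.chiral_conj, Equiv.Perm.sameCycle_inv] at h1
  exact ⟨fun h => by simpa [chiral_chiral] using key h, key⟩

/-- Two states are identified when their facial walks agree up to cyclic permutation and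
inversion. -/
def faceSetoid : Setoid (CoverArc G) where
  r u v := R.faceStep.SameCycle u v ∨ R.faceStep.SameCycle (R.chiral u) v
  iseqv :=
    { refl := fun u => Or.inl (Equiv.Perm.SameCycle.refl _ u)
      symm := by
        rintro u v (h | h)
        · exact Or.inl h.symm
        · refine Or.inr ?_
          rw [← R.sameCycle_chiral_iff, chiral_chiral]
          exact h.symm
      trans := by
        rintro u v w (h | h) (k | k)
        · exact Or.inl (h.trans k)
        · exact Or.inr ((R.sameCycle_chiral_iff.2 h).trans k)
        · exact Or.inr (h.trans k)
        · refine Or.inl (Equiv.Perm.SameCycle.trans ?_ k)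
          rw [← R.sameCycle_chiral_iff]
          simpa [chiral_chiral] using h }

/-- The set `F` of faces: facial walks up to cyclic permutation and inversion. -/
def Face : Type _ := Quotient R.faceSetoid

noncomputable instance [Fintype V] [DecidableRel G.Adj] : Fintype R.Face :=
  haveI : Finite R.Face := inferInstanceAs (Finite (Quotient R.faceSetoid))
  Fintype.ofFinite _

/-- The facial walk through the state `u` traverses the arc `e` of `G`. -/
def Traverses (u : CoverArc G) (e : G.Dart) : Prop :=
  ∃ s : ZMod 2, R.faceStep.SameCycle u (e, s)

theorem traverses_of_sameCycle {u v : CoverArc G} (h : R.faceStep.SameCycle u v) (e : G.Dart) :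
    R.Traverses u e ↔ R.Traverses v e :=
  ⟨fun ⟨s, hs⟩ => ⟨s, h.symm.trans hs⟩, fun ⟨s, hs⟩ => ⟨s, h.trans hs⟩⟩

theorem traverses_chiral (u : CoverArc G) (e : G.Dart) :
    R.Traverses (R.chiral u) e ↔ R.Traverses u e.symm := by
  have key : ∀ (u : CoverArc G) (e : G.Dart), R.Traverses u e → R.Traverses (R.chiral u) e.symm := by
    rintro u e ⟨s, hs⟩
    exact ⟨_, R.sameCycle_chiral_iff.2 hs⟩
  refine ⟨fun h => ?_, fun h => ?_⟩
  · simpa [chiral_chiral] using key _ _ h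
  · simpa using key _ _ h

theorem minimalPeriod_of_sameCycle {u v : CoverArc G} (h : R.faceStep.SameCycle u v) :
    Function.minimalPeriod R.faceStep u = Function.minimalPeriod R.faceStep v := by
  rw [Function.minimalPeriod_eq_minimalPeriod_iff]
  obtain ⟨k, rfl⟩ := h
  intro n
  simp only [Function.IsPeriodicPt, Function.IsFixedPt, ← Equiv.Perm.coe_pow,
    ← Equiv.Perm.mul_apply]
  rw [((Commute.refl R.faceStep).pow_left n).zpow_right k |>.eq, Equiv.Perm.mul_apply,
    (R.faceStep ^ k).injective.eq_iff]

theorem minimalPeriod_chiral (u : CoverArc G) :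
    Function.minimalPeriod R.faceStep (R.chiral u) = Function.minimalPeriod R.faceStep u := by
  rw [Function.minimalPeriod_eq_minimalPeriod_iff]
  intro n
  simp only [Function.IsPeriodicPt, Function.IsFixedPt, ← Equiv.Perm.coe_pow]
  have h : R.chiral * R.faceStep ^ n * R.chiral⁻¹ = (R.faceStep ^ n)⁻¹ := by
    rw [← conj_pow, chiral_conj, inv_pow]
  have h1 : R.chiral ((R.faceStep ^ n) u) = (R.faceStep ^ n)⁻¹ (R.chiral u) := by
    rw [← h]; simp
  constructor
  · intro h2
    apply R.chiral.injective
    rw [h1, Equiv.Perm.inv_eq_iff_eq, h2]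
  · intro h2
    rw [h2, Equiv.Perm.eq_inv_iff_eq] at h1
    exact h1

/-- The length `|f|` of a face: the number of arcs in the facial walk before it closes up, that is,
the least number of steps after which both the arc and the twist parity recur. -/
noncomputable def Face.length {R : RotationSystem G} (f : R.Face) : ℕ :=
  Quotient.lift (fun u => Function.minimalPeriod R.faceStep u) (by
    rintro u v (h | h)
    · exact R.minimalPeriod_of_sameCycle h
    · exact (R.minimalPeriod_chiral u).symm.trans (R.minimalPeriod_of_sameCycle h)) f

/-- The self-intersection set `f ∩ f̄` of a face: the arcs `e` of `G` such that the facial walk `f`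
traverses both `e` and the inverse of `e`. -/
def Face.selfIntersection {R : RotationSystem G} (f : R.Face) : Set G.Dart :=
  Quotient.lift (fun u => {e : G.Dart | R.Traverses u e ∧ R.Traverses u e.symm}) (by
    rintro u v (h | h)
    · ext e
      simp only [Set.mem_ofPred_eq, R.traverses_of_sameCycle h]
    · ext e
      simp only [Set.mem_ofPred_eq, ← R.traverses_of_sameCycle h, R.traverses_chiral,
        SimpleGraph.Dart.symm_symm]
      exact and_comm) f

/-! ### The quantum walk -/

end RotationSystem

/-- The arcs of the blow-up of the double cover with a tail attached to every island arc. The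
vertices of the blow-up are the arcs `u` of the double cover; each `u` carries
* the bridge arc `bridge u` from `u` to the inverse arc of `u`,
* the island arc from `u` to `(ρ ⊕ ρ⁻¹) u`, subdivided by the root of a tail into the quay arcs
  `quayMinus u` (from `u` to the root) and `quayPlus u` (from the root to `(ρ ⊕ ρ⁻¹) u`),
* the arcs of that tail, a semi-infinite path: `tailIn u n` points towards the root, `tailOut u n`
  is its inverse, and `n` is the distance to the root. -/
inductive WalkArc {V : Type*} (G : SimpleGraph V) where
  | bridge (u : CoverArc G)
  | quayMinus (u : CoverArc G)
  | quayPlus (u : CoverArc G)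
  | tailIn (u : CoverArc G) (n : ℕ)
  | tailOut (u : CoverArc G) (n : ℕ)

namespace RotationSystem

variable {V : Type*} {G : SimpleGraph V} (R : RotationSystem G)

/-- One time step of the quantum walk with coin `C = !![a, b; c, d]`. Here `a`, `b`, `c`, `d` are the
weights of moving from an island to the same island, from a bridge (or tail) to an island, from an
island to a bridge (or tail), and from a bridge (or tail) to its inverse. Twisted bridges contribute
an additional sign, and the dynamics on the tails is free. -/
def walkStep (C : Matrix (Fin 2) (Fin 2) ℂ) (ψ : WalkArc G → ℂ) : WalkArc G → ℂ
  | .bridge u => (-1 : ℂ) ^ (R.twist u.1).val *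
      (C 1 0 * ψ (.quayPlus (R.coverRot.symm u)) + C 1 1 * ψ (.bridge (R.bar u)))
  | .quayMinus u => C 0 0 * ψ (.quayPlus (R.coverRot.symm u)) + C 0 1 * ψ (.bridge (R.bar u))
  | .quayPlus u => C 0 0 * ψ (.quayMinus u) + C 0 1 * ψ (.tailIn u 0)
  | .tailIn u n => ψ (.tailIn u (n + 1))
  | .tailOut u 0 => C 1 0 * ψ (.quayMinus u) + C 1 1 * ψ (.tailIn u 0)
  | .tailOut u (n + 1) => ψ (.tailOut u n)

/-- The initial state with inflow `α`: the constant `α u` on the arcs of the tail `u` that point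
towards the interior, and `0` on all other arcs. -/
def initialState (α : CoverArc G → ℂ) : WalkArc G → ℂ
  | .tailIn u _ => α u
  | _ => 0

/-- The state of the walk at time `t`. -/
def stateAt (C : Matrix (Fin 2) (Fin 2) ℂ) (α : CoverArc G → ℂ) (t : ℕ) : WalkArc G → ℂ :=
  (R.walkStep C)^[t] (initialState α)

/-- The stationary state, the pointwise limit of the states as `t → ∞`. -/
noncomputable def stationaryState (C : Matrix (Fin 2) (Fin 2) ℂ) (α : CoverArc G → ℂ) :
    WalkArc G → ℂ :=
  fun ε => limUnder atTop (fun t : ℕ => R.stateAt C α t ε)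

/-- The comfortability: one half of the square norm of the stationary state restricted to the
internal graph, which consists of the bridge arcs and the quay arcs. -/
noncomputable def comfortability [Fintype V] [DecidableRel G.Adj]
    (C : Matrix (Fin 2) (Fin 2) ℂ) (α : CoverArc G → ℂ) : ℝ :=
  (1 / 2) * ∑ u : CoverArc G,
    (‖R.stationaryState C α (.bridge u)‖ ^ 2 + ‖R.stationaryState C α (.quayMinus u)‖ ^ 2 +
      ‖R.stationaryState C α (.quayPlus u)‖ ^ 2)

/-- The average of the comfortability over the unit inflows from a single tail, the tail being
chosen uniformly at random. -/
noncomputable def meanComfortability [Fintype V] [DecidableEq V] [DecidableRel G.Adj]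
    (C : Matrix (Fin 2) (Fin 2) ℂ) : ℝ :=
  (1 / (Fintype.card (CoverArc G) : ℝ)) *
    ∑ u : CoverArc G, R.comfortability C (Pi.single u 1)

end RotationSystem

/-! The coin is a reflection, `C * C = 1`, and this makes every bridge transparent to the stationary
state: up to the twist sign, what leaves the quay of `faceStep⁻¹ u` enters the quay of `u`.
Amplitude therefore travels along facial walks, damped by `a` and fed by the inflow at each step.
After the gauge `(-1)^s` absorbs the signs, the quay amplitudes are `b` times the resolvent `(1 -
aP)⁻¹` of the permutation `faceStep`. The state built from it is fixed by the walk
(`walkStep_explicitState`). The initial state differs from it by a state without inflow, which leaks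
out (`tendsto_walkStep_iterate_zero`), so the limit exists.

As `a = 1 - δ → 1`, `δ` times the resolvent at `δ_u` tends to the uniform distribution on the cycle
of `u` (`tendsto_mul_resolvent`, `visitMean_eq`). Quay energies carry the factor `1 - a²` and vanish
in the limit. A bridge keeps the squared difference of the uniform distribution at its two arcs, and
this counts the states of the cycle whose inverse arc lies off it. Since a facial walk is never its
own inverse (`not_sameCycle_chiral`), that count is `|f| - |f ∩ f̄|`, and each face is hit by `2|f|`
of the `4|E|` inflows. -/

/-! ### Resolvents of permutations -/

namespace Equiv.Perm

variable {X : Type*}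

/-- The resolvent `(1 - a P)⁻¹` of the permutation operator `P α v = α (σ⁻¹ v)`. -/
noncomputable def resolvent {𝕜 : Type*} [Field 𝕜] (σ : Equiv.Perm X) (a : 𝕜) (α : X → 𝕜) (v : X) :
    𝕜 :=
  (1 - a ^ orderOf σ)⁻¹ * ∑ n ∈ Finset.range (orderOf σ), a ^ n * α ((σ⁻¹ ^ n) v)

/-- Shifting a sum over a full period changes only its end terms, both taken at `v` because `σ⁻¹ ^
orderOf σ` is the identity. -/
theorem sum_range_orderOf_inv_apply {M : Type*} [AddCommGroup M] (σ : Equiv.Perm X)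
    (g : ℕ → X → M) (v : X) :
    ∑ n ∈ Finset.range (orderOf σ), g (n + 1) ((σ⁻¹ ^ n) (σ⁻¹ v)) =
      ∑ n ∈ Finset.range (orderOf σ), g n ((σ⁻¹ ^ n) v) + g (orderOf σ) v - g 0 v := by
  have h : ∀ n, g (n + 1) ((σ⁻¹ ^ n) (σ⁻¹ v)) = g (n + 1) ((σ⁻¹ ^ (n + 1)) v) := fun n => by
    rw [pow_succ, Equiv.Perm.mul_apply]
  have h1 := Finset.sum_range_succ (fun n => g n ((σ⁻¹ ^ n) v)) (orderOf σ)
  rw [Finset.sum_range_succ'] at h1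
  have h2 : (σ⁻¹ ^ orderOf σ) v = v := by
    rw [inv_pow, pow_orderOf_eq_one]; simp
  simp only [h2, pow_zero, Equiv.Perm.one_apply] at h1
  simp only [h, ← h1]
  abel

theorem resolvent_eq {𝕜 : Type*} [Field 𝕜] (σ : Equiv.Perm X) {a : 𝕜} (ha : a ^ orderOf σ ≠ 1)
    (α : X → 𝕜) (v : X) :
    σ.resolvent a α v = a * σ.resolvent a α (σ⁻¹ v) + α v := by
  have h := sum_range_orderOf_inv_apply σ (fun n w => a ^ n * α w) v
  have h1 : a * ∑ n ∈ Finset.range (orderOf σ), a ^ n * α ((σ⁻¹ ^ n) (σ⁻¹ v)) =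
      ∑ n ∈ Finset.range (orderOf σ), a ^ (n + 1) * α ((σ⁻¹ ^ n) (σ⁻¹ v)) := by
    rw [Finset.mul_sum]
    exact Finset.sum_congr rfl fun n _ => by ring
  have h2 : (1 - a ^ orderOf σ) ≠ 0 := sub_ne_zero.2 ha.symm
  unfold resolvent
  rw [mul_left_comm, h1, h]
  field_simp
  ring

/-- The mean number of visits to `v` of the orbit of `u`. -/
noncomputable def visitMean [DecidableEq X] (σ : Equiv.Perm X) (u v : X) : ℝ :=
  (orderOf σ : ℝ)⁻¹ * ∑ n ∈ Finset.range (orderOf σ), if (σ⁻¹ ^ n) v = u then 1 else 0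

/-- The pole is simple: `1 - (1 - δ)^N` is `δ` times a geometric sum tending to `N`. -/
theorem tendsto_mul_resolvent [Finite X] [DecidableEq X] (σ : Equiv.Perm X) (u v : X) :
    Tendsto (fun δ : ℝ => δ * σ.resolvent (1 - δ) (Pi.single u 1) v) (𝓝[>] 0)
      (𝓝 (σ.visitMean u v)) := by
  have hN : orderOf σ ≠ 0 := (orderOf_pos σ).ne'
  have h1 : Tendsto (fun δ : ℝ => (∑ n ∈ Finset.range (orderOf σ), (1 - δ) ^ n)⁻¹) (𝓝[>] 0)
      (𝓝 (orderOf σ : ℝ)⁻¹) := by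
    refine Tendsto.mono_left ?_ nhdsWithin_le_nhds
    refine Tendsto.inv₀ ?_ (by exact_mod_cast hN)
    have : Continuous fun δ : ℝ => ∑ n ∈ Finset.range (orderOf σ), (1 - δ) ^ n := by fun_prop
    simpa using this.tendsto 0
  have h2 : Tendsto (fun δ : ℝ => ∑ n ∈ Finset.range (orderOf σ),
      (1 - δ) ^ n * (Pi.single u 1 : X → ℝ) ((σ⁻¹ ^ n) v)) (𝓝[>] 0)
      (𝓝 (∑ n ∈ Finset.range (orderOf σ), if (σ⁻¹ ^ n) v = u then 1 else 0)) := by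
    refine Tendsto.mono_left ?_ nhdsWithin_le_nhds
    have : Continuous fun δ : ℝ => ∑ n ∈ Finset.range (orderOf σ),
      (1 - δ) ^ n * (Pi.single u 1 : X → ℝ) ((σ⁻¹ ^ n) v) := by fun_prop
    simpa [Pi.single_apply] using this.tendsto 0
  refine (h1.mul h2).congr' ?_
  filter_upwards [self_mem_nhdsWithin] with δ hδ
  have hδ' : δ ≠ 0 := ne_of_gt hδ
  have h3 : 1 - (1 - δ) ^ orderOf σ = δ * ∑ n ∈ Finset.range (orderOf σ), (1 - δ) ^ n := by
    have := mul_neg_geom_sum (1 - δ) (orderOf σ)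
    rw [← this]; ring
  rw [resolvent, h3, mul_inv, ← mul_assoc, ← mul_assoc, mul_inv_cancel₀ hδ', one_mul]

theorem visitMean_inv_apply [DecidableEq X] (σ : Equiv.Perm X) (u v : X) :
    σ.visitMean u (σ⁻¹ v) = σ.visitMean u v := by
  have h := sum_range_orderOf_inv_apply σ (fun _ w => if w = u then (1 : ℝ) else 0) v
  unfold visitMean
  rw [h]
  simp

theorem visitMean_eq_of_sameCycle [DecidableEq X] {σ : Equiv.Perm X} {u v w : X}
    (h : σ.SameCycle v w) : σ.visitMean u w = σ.visitMean u v := by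
  obtain ⟨k, rfl⟩ := h
  have h1 : ∀ v, σ.visitMean u (σ v) = σ.visitMean u v := fun v => by
    rw [← visitMean_inv_apply]; simp
  induction k with
  | zero => simp
  | succ k ih => rw [add_comm, zpow_add, zpow_one, Equiv.Perm.mul_apply, h1, ih]
  | pred k ih =>
    rw [sub_eq_neg_add, zpow_add, zpow_neg_one, Equiv.Perm.mul_apply, visitMean_inv_apply, ih]

theorem card_sameCycle [Finite X] (σ : Equiv.Perm X) (u : X) :
    Nat.card {v // σ.SameCycle u v} = Function.minimalPeriod σ u := by
  classical
  have := Fintype.ofFinite X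
  have h := MulAction.minimalPeriod_eq_card (a := σ) (b := u)
  change Function.minimalPeriod σ u = _ at h
  rw [h, ← Nat.card_eq_fintype_card]
  refine Nat.card_congr (Equiv.subtypeEquivRight fun v => ?_)
  rw [MulAction.mem_orbit_iff]
  constructor
  · rintro ⟨k, hk⟩
    exact ⟨⟨σ ^ k, ⟨k, rfl⟩⟩, hk⟩
  · rintro ⟨⟨_, ⟨k, rfl⟩⟩, hk⟩
    exact ⟨k, hk⟩

theorem card_filter_sameCycle [Fintype X] (σ : Equiv.Perm X) (u : X)
    [DecidablePred (σ.SameCycle u)] :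
    (Finset.univ.filter fun v => σ.SameCycle u v).card = Function.minimalPeriod σ u := by
  rw [← card_sameCycle, Nat.card_eq_fintype_card, Fintype.card_subtype]

theorem minimalPeriod_pos [Finite X] (σ : Equiv.Perm X) (u : X) :
    0 < Function.minimalPeriod σ u := by
  rw [← card_sameCycle]
  have : Nonempty {v // σ.SameCycle u v} := ⟨⟨u, SameCycle.refl σ u⟩⟩
  exact Nat.card_pos

/-- The visit mean is constant on cycles, vanishes off the cycle of `u` and has total mass 1, hence
is uniform on that cycle. -/
theorem visitMean_eq [Fintype X] [DecidableEq X] (σ : Equiv.Perm X) (u v : X)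
    [DecidablePred (σ.SameCycle u)] :
    σ.visitMean u v = if σ.SameCycle u v then (Function.minimalPeriod σ u : ℝ)⁻¹ else 0 := by
  have h0 : ∀ w, ¬ σ.SameCycle u w → σ.visitMean u w = 0 := by
    intro w hw
    unfold visitMean
    rw [Finset.sum_eq_zero, mul_zero]
    intro n _
    rw [if_neg]
    rintro rfl
    exact hw ⟨n, by simp [inv_pow]⟩
  have hsum : ∑ w, σ.visitMean u w = 1 := by
    have hN : (orderOf σ : ℝ) ≠ 0 := by exact_mod_cast (orderOf_pos σ).ne'
    unfold visitMean
    rw [← Finset.mul_sum, Finset.sum_comm]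
    have : ∀ n, ∑ w, (if (σ⁻¹ ^ n) w = u then (1 : ℝ) else 0) = 1 := by
      intro n
      rw [Equiv.sum_comp (σ⁻¹ ^ n) (fun w => if w = u then (1 : ℝ) else 0)]
      simp
    rw [Finset.sum_congr rfl fun n _ => this n]
    simp [hN]
  have h1 : ∑ w, σ.visitMean u w = Function.minimalPeriod σ u * σ.visitMean u u := by
    rw [← card_filter_sameCycle, ← nsmul_eq_mul, ← Finset.sum_const, Finset.sum_filter]
    refine Finset.sum_congr rfl fun w _ => ?_
    split_ifs with hw
    · exact visitMean_eq_of_sameCycle hw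
    · exact h0 w hw
  split_ifs with hv
  · rw [visitMean_eq_of_sameCycle hv]
    exact eq_inv_of_mul_eq_one_right (h1.symm.trans hsum)
  · exact h0 v hv

end Equiv.Perm

/-! ### Combinatorics of faces -/

namespace RotationSystem

variable {V : Type*} {G : SimpleGraph V} (R : RotationSystem G)

theorem chiral_ne (u : CoverArc G) : R.chiral u ≠ u := fun h =>
  u.1.symm_ne (congrArg Prod.fst h)

/-- If the arcs agree, the rotation fixes the arc of `u`; the sheets then differ by 1. -/
theorem faceStep_ne_chiral (u : CoverArc G) : R.faceStep u ≠ R.chiral u := by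
  intro h
  have hst : ∀ s t : ZMod 2, s + t ≠ s + t + 1 := by decide
  have h1 := congrArg Prod.fst h
  have h2 := congrArg Prod.snd h
  simp only [faceStep, chiral, bar, coverRot, Equiv.trans_apply, Equiv.coe_fn_mk] at h1 h2
  have h3 := congrArg SimpleGraph.Dart.symm h1
  simp only [SimpleGraph.Dart.symm_symm] at h3
  rw [h3] at h2
  exact hst _ _ h2

theorem chiral_zpow_faceStep (u : CoverArc G) (k : ℤ) :
    R.chiral ((R.faceStep ^ k) u) = (R.faceStep ^ (-k)) (R.chiral u) := by
  have h : R.chiral * R.faceStep ^ k * R.chiral⁻¹ = R.faceStep ^ (-k) := by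
    rw [← conj_zpow, chiral_conj, inv_zpow, zpow_neg]
  rw [← h]
  simp

/-- A facial walk never coincides with its inverse. -/
theorem not_sameCycle_chiral (u : CoverArc G) : ¬ R.faceStep.SameCycle u (R.chiral u) := by
  rintro ⟨k, hk⟩
  have h : ∀ j, R.chiral ((R.faceStep ^ j) u) = (R.faceStep ^ (k - j)) u := fun j => by
    rw [chiral_zpow_faceStep, ← hk, ← Equiv.Perm.mul_apply, ← zpow_add, neg_add_eq_sub]
  -- Look at the middle of the path from `u` to its reversal. For even `k` the midpoint would be
  -- fixed by `chiral`; for odd `k` `chiral` would send a state to its successor.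
  rcases Int.even_or_odd k with ⟨j, rfl⟩ | ⟨j, rfl⟩
  · exact R.chiral_ne _ ((h j).trans (by simp))
  · refine R.faceStep_ne_chiral ((R.faceStep ^ j) u) ?_
    rw [h j, ← Equiv.Perm.mul_apply, ← zpow_one_add]
    congr 2
    ring

theorem bar_bar (u : CoverArc G) : R.bar (R.bar u) = u := R.bar.left_inv u

/-- The number of states `v` on the facial walk through `u` whose inverse in the double cover is
again on that walk is the size of the self-intersection of the face. -/
theorem ncard_selfIntersection (u : CoverArc G) :
    (Face.selfIntersection (R := R) (Quotient.mk R.faceSetoid u)).ncard =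
      {v | R.faceStep.SameCycle u v ∧ R.faceStep.SameCycle u (R.bar v)}.ncard := by
  -- Of the two states over `e.symm`, one is `bar (e, s)` and the other `chiral (e, s)`; the latter
  -- is never on the walk.
  have hsplit : ∀ (e : G.Dart) (s t : ZMod 2), R.faceStep.SameCycle u (e, s) →
      R.faceStep.SameCycle u (e.symm, t) → t = s + R.twist e := by
    intro e s t h1 h2
    by_contra hne
    refine R.not_sameCycle_chiral (e, s) (h1.symm.trans ?_)
    have : R.chiral (e, s) = (e.symm, t) := by
      have hz : ∀ t w : ZMod 2, t ≠ w → w + 1 = t := by decide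
      exact Prod.ext rfl (hz _ _ hne)
    rwa [this]
  symm
  refine Set.ncard_congr (fun v _ => v.1) ?_ ?_ ?_
  · rintro ⟨e, s⟩ ⟨h1, h2⟩
    exact ⟨⟨s, h1⟩, ⟨_, h2⟩⟩
  · rintro ⟨e, s⟩ ⟨e', s'⟩ ⟨h1, h2⟩ ⟨h3, h4⟩ (rfl : e = e')
    have := hsplit e s' _ h3 h2
    exact Prod.ext rfl (add_right_cancel this)
  · rintro e ⟨⟨s, hs⟩, ⟨t, ht⟩⟩
    refine ⟨(e, s), ⟨hs, ?_⟩, rfl⟩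
    rwa [hsplit e s t hs ht] at ht

/-! ### Counting states on faces -/

section Fintype

variable [Fintype V] [DecidableEq V] [DecidableRel G.Adj]

open Classical in
/-- The states on a face: those on one of the two mutually inverse facial walks. -/
theorem card_fiber_face (u : CoverArc G) :
    (Finset.univ.filter fun v : CoverArc G =>
      (Quotient.mk R.faceSetoid v) = Quotient.mk R.faceSetoid u).card =
      2 * Function.minimalPeriod R.faceStep u := by
  have h : (Finset.univ.filter fun v : CoverArc G =>
      (Quotient.mk R.faceSetoid v) = Quotient.mk R.faceSetoid u) =
      (Finset.univ.filter fun v => R.faceStep.SameCycle u v) ∪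
        (Finset.univ.filter fun v => R.faceStep.SameCycle (R.chiral u) v) := by
    ext v
    simp only [Finset.mem_filter, Finset.mem_univ, true_and, Finset.mem_union]
    rw [eq_comm, Quotient.eq]
    rfl
  rw [h, Finset.card_union_of_disjoint, Equiv.Perm.card_filter_sameCycle,
    Equiv.Perm.card_filter_sameCycle, minimalPeriod_chiral, two_mul]
  rw [Finset.disjoint_filter]
  exact fun v _ h1 h2 => R.not_sameCycle_chiral u (h1.trans h2.symm)

theorem sum_face_eq (φ : R.Face → ℝ) :
    ∑ u : CoverArc G, φ (Quotient.mk R.faceSetoid u) = ∑ f : R.Face, 2 * (f.length : ℝ) * φ f := by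
  classical
  rw [← Finset.sum_fiberwise_of_maps_to (t := (Finset.univ : Finset R.Face))
    (g := fun u => (Quotient.mk R.faceSetoid u : R.Face)) (fun _ _ => Finset.mem_univ _)]
  refine Finset.sum_congr rfl fun f _ => ?_
  induction f using Quotient.inductionOn with
  | h u =>
    rw [Finset.sum_congr rfl (g := fun _ => φ (Quotient.mk R.faceSetoid u))
      (fun v hv => by rw [(Finset.mem_filter.1 hv).2]), Finset.sum_const, nsmul_eq_mul]
    have := R.card_fiber_face u
    congr 1
    have h2 : (Face.length (R := R) (Quotient.mk R.faceSetoid u)) =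
      Function.minimalPeriod R.faceStep u := rfl
    rw [h2]
    rw [← Nat.cast_ofNat (R := ℝ), ← Nat.cast_mul, ← this]
    congr!

/-- Both visit means are `1/l` times indicators, and a squared difference of indicators is their sum
minus twice their product. -/
theorem sum_sq_visitMean_sub (u : CoverArc G) :
    ∑ v, (R.faceStep.visitMean u (R.bar v) - R.faceStep.visitMean u v) ^ 2 =
      2 * (Face.length (R := R) (Quotient.mk R.faceSetoid u) : ℝ)⁻¹ *
        (1 - (Face.selfIntersection (R := R) (Quotient.mk R.faceSetoid u)).ncard /
          (Face.length (R := R) (Quotient.mk R.faceSetoid u) : ℝ)) := by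
  classical
  rw [ncard_selfIntersection]
  change _ = 2 * (Function.minimalPeriod R.faceStep u : ℝ)⁻¹ *
    (1 - _ / (Function.minimalPeriod R.faceStep u : ℝ))
  have hl : (Function.minimalPeriod R.faceStep u : ℝ) ≠ 0 := by
    exact_mod_cast (R.faceStep.minimalPeriod_pos u).ne'
  have hc := R.faceStep.card_filter_sameCycle u
  set l := Function.minimalPeriod R.faceStep u with hldef
  have h1 : ∑ v, (if R.faceStep.SameCycle u v then (1 : ℝ) else 0) = l := by
    rw [Finset.sum_boole, hc]
  have h2 : ∑ v, (if R.faceStep.SameCycle u (R.bar v) then (1 : ℝ) else 0) = l := by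
    rw [← h1, ← Equiv.sum_comp R.bar (fun v => if R.faceStep.SameCycle u v then (1 : ℝ) else 0)]
  have h3 : ∑ v, (if R.faceStep.SameCycle u v ∧ R.faceStep.SameCycle u (R.bar v)
      then (1 : ℝ) else 0) =
      ({v | R.faceStep.SameCycle u v ∧ R.faceStep.SameCycle u (R.bar v)}.ncard : ℝ) := by
    rw [Finset.sum_boole, Set.ncard_eq_toFinset_card']
    congr 2
    ext; simp
  rw [← h3]
  have h4 : ∀ v, (R.faceStep.visitMean u (R.bar v) - R.faceStep.visitMean u v) ^ 2 =
      (l : ℝ)⁻¹ ^ 2 * ((if R.faceStep.SameCycle u (R.bar v) then (1 : ℝ) else 0) +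
        (if R.faceStep.SameCycle u v then (1 : ℝ) else 0) -
        2 * (if R.faceStep.SameCycle u v ∧ R.faceStep.SameCycle u (R.bar v)
          then (1 : ℝ) else 0)) := by
    intro v
    have e1 := R.faceStep.visitMean_eq u v
    have e2 := R.faceStep.visitMean_eq u (R.bar v)
    rw [← hldef] at e1 e2
    rw [e1, e2]
    by_cases k1 : R.faceStep.SameCycle u v <;> by_cases k2 : R.faceStep.SameCycle u (R.bar v) <;>
      simp only [k1, k2, if_true, if_false, and_true, and_false] <;> ring
  simp_rw [h4]
  rw [← Finset.mul_sum, Finset.sum_sub_distrib, Finset.sum_add_distrib, h1, h2, ← Finset.mul_sum]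
  field_simp
  ring

omit [DecidableEq V] in
theorem card_coverArc : (Fintype.card (CoverArc G) : ℝ) = 4 * (G.edgeSet.ncard : ℝ) := by
  rw [Fintype.card_prod, SimpleGraph.dart_card_eq_twice_card_edges, ZMod.card,
    ← SimpleGraph.coe_edgeFinset, Set.ncard_coe_finset]
  push_cast
  ring

end Fintype

end RotationSystem

/-! ### The quantum walk -/

open scoped ComplexConjugate

/-- A unitary coin with determinant `-1` and real diagonal is a reflection. -/
theorem Matrix.eq_of_mem_unitaryGroup_of_det_eq_neg_one {C : Matrix (Fin 2) (Fin 2) ℂ} {a : ℝ}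
    (hC : C ∈ Matrix.unitaryGroup (Fin 2) ℂ) (ha : C 0 0 = a) (hdet : -C.det = 1) :
    a ^ 2 + ‖C 0 1‖ ^ 2 = 1 ∧ C = !![(a : ℂ), C 0 1; conj (C 0 1), -a] := by
  have h1 := Matrix.mem_unitaryGroup_iff.1 hC
  -- Determinant `-1` makes the inverse, that is `star C`, equal to `-C.adjugate`; the shape of `C`
  -- is read off entrywise.
  have h2 : C * C.adjugate = -1 := by
    rw [Matrix.mul_adjugate, neg_eq_iff_eq_neg.1 hdet]; simp
  have h3 : star C = -C.adjugate := by
    have h4 : star C * C = 1 := Matrix.mem_unitaryGroup_iff'.1 hC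
    calc star C = star C * (C * -C.adjugate) := by rw [mul_neg, h2, neg_neg, mul_one]
      _ = -C.adjugate := by rw [← mul_assoc, h4, one_mul]
  have h5 : ∀ i j, conj (C j i) = -C.adjugate i j := fun i j => congrFun (congrFun h3 i) j
  have e00 := h5 0 0
  have e10 := h5 1 0
  simp only [Matrix.adjugate_fin_two, Matrix.of_apply, Matrix.cons_val', Matrix.cons_val_zero,
    Matrix.cons_val_one, Matrix.cons_val_fin_one, neg_neg] at e00 e10
  rw [ha, Complex.conj_ofReal] at e00
  have e11 : C 1 1 = -a := by rw [e00, neg_neg]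
  constructor
  · rw [Matrix.det_fin_two, ha, e11, ← e10, Complex.mul_conj] at hdet
    rw [Complex.sq_norm]
    have : ((a ^ 2 + Complex.normSq (C 0 1) : ℝ) : ℂ) = 1 := by
      push_cast
      linear_combination hdet
    exact_mod_cast this
  · ext i j
    fin_cases i <;> fin_cases j
    · exact ha
    · rfl
    · exact e10.symm
    · exact e11

theorem norm_sq_reflection {a : ℝ} {b : ℂ} (hab : a ^ 2 + ‖b‖ ^ 2 = 1) (x y : ℂ) :
    ‖conj b * x + -a * y‖ ^ 2 + ‖a * x + b * y‖ ^ 2 = ‖x‖ ^ 2 + ‖y‖ ^ 2 := by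
  simp only [Complex.sq_norm, Complex.normSq_apply] at hab ⊢
  simp
  linear_combination (x.re * x.re + x.im * x.im + y.re * y.re + y.im * y.im) * hab

/-- The character of `ZMod 2`. -/
def twistSign (s : ZMod 2) : ℂ := (-1) ^ s.val

theorem twistSign_add (s t : ZMod 2) : twistSign (s + t) = twistSign s * twistSign t := by
  have h : ∀ s t : ZMod 2, (s + t).val = (s.val + t.val) % 2 := by decide
  rw [twistSign, twistSign, twistSign, h, ← pow_add, ← neg_one_pow_eq_pow_mod_two]

theorem twistSign_mul_self (s : ZMod 2) : twistSign s * twistSign s = 1 := by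
  rw [← twistSign_add, CharTwo.add_self_eq_zero]; simp [twistSign]

theorem norm_twistSign (s : ZMod 2) : ‖twistSign s‖ = 1 := by simp [twistSign]

namespace RotationSystem

variable {V : Type*} {G : SimpleGraph V} (R : RotationSystem G)

theorem walkStep_sub (C : Matrix (Fin 2) (Fin 2) ℂ) (ψ φ : WalkArc G → ℂ) :
    R.walkStep C (ψ - φ) = R.walkStep C ψ - R.walkStep C φ := by
  ext ε
  rcases ε with u | u | u | ⟨u, n⟩ | ⟨u, _ | n⟩ <;> simp [walkStep] <;> ring

theorem walkStep_iterate_sub (C : Matrix (Fin 2) (Fin 2) ℂ) (ψ φ : WalkArc G → ℂ) (t : ℕ) :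
    (R.walkStep C)^[t] (ψ - φ) = (R.walkStep C)^[t] ψ - (R.walkStep C)^[t] φ := by
  induction t with
  | zero => rfl
  | succ t ih => simp only [Function.iterate_succ_apply', ih, walkStep_sub]

/-! ### Decay of states without inflow -/

section Decay

variable [Fintype V] [DecidableRel G.Adj]

/-- The square norm of a state on the internal graph. -/
noncomputable def energy (ψ : WalkArc G → ℂ) : ℝ :=
  ∑ u : CoverArc G,
    (‖ψ (.bridge u)‖ ^ 2 + ‖ψ (.quayMinus u)‖ ^ 2 + ‖ψ (.quayPlus u)‖ ^ 2)

/-- Scattering at the bridges is isometric. Energy is lost only at the tail roots, where the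
fraction `‖b‖²` of the incoming quay energy escapes. -/
theorem energy_walkStep {a : ℝ} {b : ℂ} (hab : a ^ 2 + ‖b‖ ^ 2 = 1) {ψ : WalkArc G → ℂ}
    (hψ : ∀ u n, ψ (.tailIn u n) = 0) :
    energy (R.walkStep !![(a : ℂ), b; conj b, -a] ψ) =
      energy ψ - ‖b‖ ^ 2 * ∑ u : CoverArc G, ‖ψ (.quayMinus u)‖ ^ 2 := by
  have h1 : ∀ u : CoverArc G,
      ‖R.walkStep !![(a : ℂ), b; conj b, -a] ψ (.bridge u)‖ ^ 2 +
        ‖R.walkStep !![(a : ℂ), b; conj b, -a] ψ (.quayMinus u)‖ ^ 2 =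
      ‖ψ (.quayPlus (R.coverRot.symm u))‖ ^ 2 + ‖ψ (.bridge (R.bar u))‖ ^ 2 := by
    intro u
    rw [← norm_sq_reflection hab (ψ (.quayPlus (R.coverRot.symm u)))]
    simp [walkStep]
  have h2 : ∀ u : CoverArc G,
      ‖R.walkStep !![(a : ℂ), b; conj b, -a] ψ (.quayPlus u)‖ ^ 2 =
        a ^ 2 * ‖ψ (.quayMinus u)‖ ^ 2 := by
    intro u
    simp [walkStep, hψ, mul_pow]
  unfold energy
  simp_rw [h1, h2]
  simp only [Finset.sum_add_distrib, ← Finset.mul_sum]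
  rw [Equiv.sum_comp R.coverRot.symm (fun u => ‖ψ (.quayPlus u)‖ ^ 2),
    Equiv.sum_comp R.bar (fun u => ‖ψ (.bridge u)‖ ^ 2)]
  linear_combination (∑ u : CoverArc G, ‖ψ (.quayMinus u)‖ ^ 2) * hab

/-- Without inflow the walk leaks out of every bounded region. -/
theorem tendsto_walkStep_iterate_zero {a : ℝ} {b : ℂ} (hab : a ^ 2 + ‖b‖ ^ 2 = 1) (hb : b ≠ 0)
    {ψ : WalkArc G → ℂ} (hψ : ∀ u n, ψ (.tailIn u n) = 0) (ε : WalkArc G) :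
    Tendsto (fun t : ℕ => (R.walkStep !![(a : ℂ), b; conj b, -a])^[t] ψ ε) atTop (𝓝 0) := by
  set D : ℕ → WalkArc G → ℂ := fun t => (R.walkStep !![(a : ℂ), b; conj b, -a])^[t] ψ with hD
  have hs : ∀ t, D (t + 1) = R.walkStep !![(a : ℂ), b; conj b, -a] (D t) := fun t =>
    Function.iterate_succ_apply' _ _ _
  have hin : ∀ t u n, D t (.tailIn u n) = 0 := by
    intro t
    induction t with
    | zero => exact hψ
    | succ t ih => intro u n; rw [hs]; exact ih u (n + 1)
  have hb2 : 0 < ‖b‖ ^ 2 := by positivity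
  have hE : ∀ t, energy (D (t + 1)) =
      energy (D t) - ‖b‖ ^ 2 * ∑ u : CoverArc G, ‖D t (.quayMinus u)‖ ^ 2 := fun t => by
    rw [hs, R.energy_walkStep hab (hin t)]
  have hanti : Antitone fun t => energy (D t) := antitone_nat_of_succ_le fun t => by
    rw [hE]
    have : 0 ≤ ‖b‖ ^ 2 * ∑ u : CoverArc G, ‖D t (.quayMinus u)‖ ^ 2 := by positivity
    linarith
  have hbdd : BddBelow (Set.range fun t => energy (D t)) :=
    ⟨0, by rintro _ ⟨t, rfl⟩; exact Finset.sum_nonneg fun u _ => by positivity⟩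
  have hlim := tendsto_atTop_ciInf hanti hbdd
  -- The energy converges, so its successive losses tend to zero.
  have hsum : Tendsto (fun t => ∑ u : CoverArc G, ‖D t (.quayMinus u)‖ ^ 2) atTop (𝓝 0) := by
    have h1 := (hlim.sub (hlim.comp (tendsto_add_atTop_nat 1))).const_mul (‖b‖ ^ 2)⁻¹
    rw [sub_self, mul_zero] at h1
    refine h1.congr fun t => ?_
    simp only [Function.comp_apply, hE]
    field_simp
    ring
  have hminus : ∀ u, Tendsto (fun t => D t (.quayMinus u)) atTop (𝓝 0) := by
    intro u
    have h1 : Tendsto (fun t => ‖D t (.quayMinus u)‖ ^ 2) atTop (𝓝 0) :=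
      squeeze_zero (fun t => by positivity)
        (fun t => Finset.single_le_sum (f := fun u : CoverArc G => ‖D t (.quayMinus u)‖ ^ 2)
          (fun _ _ => by positivity) (Finset.mem_univ u)) hsum
    rw [tendsto_zero_iff_norm_tendsto_zero]
    simpa using h1.sqrt
  have hplus : ∀ u, Tendsto (fun t => D t (.quayPlus u)) atTop (𝓝 0) := by
    intro u
    rw [← tendsto_add_atTop_iff_nat 1]
    have h1 := (hminus u).const_mul (a : ℂ)
    rw [mul_zero] at h1
    refine h1.congr fun t => ?_
    rw [hs]
    simp [walkStep, hin]
  -- The bridge amplitude is recovered from the next value at `quayMinus (bar u)`, whose update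
  -- contains it with the coefficient `b ≠ 0`.
  have hbridge : ∀ u, Tendsto (fun t => D t (.bridge u)) atTop (𝓝 0) := by
    intro u
    have h1 := (((hminus (R.bar u)).comp (tendsto_add_atTop_nat 1)).sub
      ((hplus (R.coverRot.symm (R.bar u))).const_mul (a : ℂ))).const_mul b⁻¹
    rw [mul_zero, sub_zero, mul_zero] at h1
    refine h1.congr fun t => ?_
    simp only [Function.comp_apply, hs]
    simp [walkStep, bar_bar, hb]
  have hout : ∀ n u, Tendsto (fun t => D t (.tailOut u n)) atTop (𝓝 0) := by
    intro n u
    rw [← tendsto_add_atTop_iff_nat 1]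
    induction n with
    | zero =>
      have h1 := (hminus u).const_mul (conj b)
      rw [mul_zero] at h1
      refine h1.congr fun t => ?_
      rw [hs]
      simp [walkStep, hin]
    | succ n ih =>
      rw [tendsto_add_atTop_iff_nat 1 (f := fun t => D t (.tailOut u n))] at ih
      exact ih.congr fun t => by rw [hs]; rfl
  rcases ε with u | u | u | ⟨u, n⟩ | ⟨u, n⟩
  · exact hbridge u
  · exact hminus u
  · exact hplus u
  · exact tendsto_const_nhds.congr fun t => (hin t u n).symm
  · exact hout n u

end Decay

/-- The gauge transformation that turns the twisted face tracing operator into a permutation. -/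
def gauge (u : CoverArc G) : ℂ := twistSign u.2

theorem gauge_mul_self (u : CoverArc G) : gauge u * gauge u = 1 := twistSign_mul_self u.2

theorem norm_gauge (u : CoverArc G) : ‖gauge u‖ = 1 := norm_twistSign u.2

theorem gauge_bar (u : CoverArc G) : gauge (R.bar u) = gauge u * twistSign (R.twist u.1) :=
  twistSign_add _ _

theorem faceStep_inv_apply (u : CoverArc G) : R.faceStep⁻¹ u = R.coverRot.symm (R.bar u) := rfl

theorem coverRot_symm_apply (u : CoverArc G) : R.coverRot.symm u = R.faceStep⁻¹ (R.bar u) := by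
  rw [faceStep_inv_apply, bar_bar]

/-- The rotation preserves sheets, so only crossing the bridge changes the gauge, by exactly the
twist sign. -/
theorem gauge_faceStep_inv (u : CoverArc G) :
    gauge (R.faceStep⁻¹ u) = gauge u * twistSign (R.twist u.1) := R.gauge_bar u

/-- The face tracing resolvent of an inflow. -/
noncomputable def faceResolvent (a : ℝ) (α : CoverArc G → ℂ) : CoverArc G → ℂ :=
  R.faceStep.resolvent (a : ℂ) (fun v => gauge v * α v)

/-- The explicit stationary state of the walk with the coin `!![a, b; conj b, -a]`. -/
noncomputable def explicitState (a : ℝ) (b : ℂ) (α : CoverArc G → ℂ) : WalkArc G → ℂ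
  | .bridge u => gauge u * twistSign (R.twist u.1) *
      (R.faceResolvent a α (R.faceStep⁻¹ (R.bar u)) -
        a * R.faceResolvent a α (R.faceStep⁻¹ u))
  | .quayMinus u => b * gauge u * R.faceResolvent a α (R.faceStep⁻¹ u)
  | .quayPlus u => b * gauge u * R.faceResolvent a α u
  | .tailIn u _ => α u
  | .tailOut u _ => conj b * (b * gauge u * R.faceResolvent a α (R.faceStep⁻¹ u)) + -a * α u

theorem walkStep_explicitState {a : ℝ} {b : ℂ} (hab : a ^ 2 + ‖b‖ ^ 2 = 1)
    (ha : a ^ orderOf R.faceStep ≠ 1) (α : CoverArc G → ℂ) :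
    R.walkStep !![(a : ℂ), b; conj b, -a] (R.explicitState a b α) = R.explicitState a b α := by
  have hcb : conj b * b = 1 - (a : ℂ) ^ 2 := by
    rw [mul_comm, Complex.mul_conj, ← Complex.sq_norm, eq_sub_of_add_eq' hab]
    push_cast
    rfl
  have hH : ∀ v, R.faceResolvent a α v =
      a * R.faceResolvent a α (R.faceStep⁻¹ v) + gauge v * α v := fun v =>
    Equiv.Perm.resolvent_eq R.faceStep (by exact_mod_cast ha) _ v
  have htb : ∀ u : CoverArc G, R.twist (R.bar u).1 = R.twist u.1 := fun u => R.twist_symm u.1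
  have hp : ∀ u : CoverArc G, gauge (R.faceStep⁻¹ (R.bar u)) = gauge u := fun u => by
    rw [gauge_faceStep_inv, gauge_bar, htb, mul_assoc, twistSign_mul_self, mul_one]
  have ht : ∀ u : CoverArc G, (-1 : ℂ) ^ (R.twist u.1).val = twistSign (R.twist u.1) :=
    fun u => rfl
  ext ε
  rcases ε with u | u | u | ⟨u, n⟩ | ⟨u, _ | n⟩
  · have hs := twistSign_mul_self (R.twist u.1)
    simp only [walkStep, explicitState, coverRot_symm_apply, hp, htb, gauge_bar, bar_bar, ht,
      Matrix.of_apply, Matrix.cons_val', Matrix.cons_val_zero, Matrix.cons_val_one,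
      Matrix.cons_val_fin_one]
    generalize R.faceResolvent a α (R.faceStep⁻¹ (R.bar u)) = x
    generalize R.faceResolvent a α (R.faceStep⁻¹ u) = y
    generalize twistSign (R.twist u.1) = s at *
    linear_combination (s * gauge u * x) * hcb - a * gauge u * s * (y - a * x) * hs
  · have hs := twistSign_mul_self (R.twist u.1)
    simp only [walkStep, explicitState, coverRot_symm_apply, hp, htb, gauge_bar, bar_bar,
      Matrix.of_apply, Matrix.cons_val', Matrix.cons_val_zero, Matrix.cons_val_one,
      Matrix.cons_val_fin_one]
    generalize R.faceResolvent a α (R.faceStep⁻¹ (R.bar u)) = x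
    generalize R.faceResolvent a α (R.faceStep⁻¹ u) = y
    generalize twistSign (R.twist u.1) = s at *
    linear_combination b * gauge u * (y - a * x) * hs
  -- Only this component uses the resolvent equation; the others would hold for any function in
  -- place of `faceResolvent`.
  · simp only [walkStep, explicitState, Matrix.of_apply, Matrix.cons_val', Matrix.cons_val_zero,
      Matrix.cons_val_one, Matrix.cons_val_fin_one]
    rw [hH u]
    linear_combination -(b * α u) * gauge_mul_self u
  · rfl
  · rfl
  · rfl

/-- For a point inflow the gauge contributes one global sign, so norms depend only on a real
resolvent. -/
theorem faceResolvent_single [DecidableEq V] (a : ℝ) (u v : CoverArc G) :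
    R.faceResolvent a (Pi.single u 1) v =
      gauge u * (R.faceStep.resolvent a (Pi.single u 1) v : ℝ) := by
  unfold faceResolvent Equiv.Perm.resolvent
  rw [Complex.ofReal_mul, Complex.ofReal_inv, Complex.ofReal_sub, Complex.ofReal_one,
    Complex.ofReal_pow, Complex.ofReal_sum, mul_left_comm, Finset.mul_sum (a := gauge u)]
  congr 1
  refine Finset.sum_congr rfl fun n _ => ?_
  generalize (R.faceStep⁻¹ ^ n) v = w
  by_cases h : w = u
  · simp [h, mul_comm]
  · simp [h]

/-! ### Convergence to the stationary state and the limit `δ → 0` -/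

section Limit

variable [Fintype V] [DecidableRel G.Adj]

theorem tendsto_stateAt_explicitState {a : ℝ} {b : ℂ} (hab : a ^ 2 + ‖b‖ ^ 2 = 1) (hb : b ≠ 0)
    (ha : a ^ orderOf R.faceStep ≠ 1) (α : CoverArc G → ℂ) (ε : WalkArc G) :
    Tendsto (fun t : ℕ => R.stateAt !![(a : ℂ), b; conj b, -a] α t ε) atTop
      (𝓝 (R.explicitState a b α ε)) := by
  have h := (R.tendsto_walkStep_iterate_zero hab hb
    (ψ := initialState α - R.explicitState a b α)
    (fun u n => by simp [initialState, explicitState]) ε).add_const (R.explicitState a b α ε)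
  rw [zero_add] at h
  refine h.congr fun t => ?_
  rw [walkStep_iterate_sub, Function.iterate_fixed (R.walkStep_explicitState hab ha α)]
  simp [stateAt]

/-- The comfortability for the unit inflow from the tail `u`. -/
theorem comfortability_single [DecidableEq V] {a : ℝ} {b : ℂ} (hab : a ^ 2 + ‖b‖ ^ 2 = 1) (hb : b ≠ 0)
    (ha : a ^ orderOf R.faceStep ≠ 1) (u : CoverArc G) :
    R.comfortability !![(a : ℂ), b; conj b, -a] (Pi.single u 1) = (1 / 2) * ∑ v : CoverArc G,
      ((R.faceStep.resolvent a (Pi.single u 1) (R.faceStep⁻¹ (R.bar v)) -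
        a * R.faceStep.resolvent a (Pi.single u 1) (R.faceStep⁻¹ v)) ^ 2 +
      (1 - a ^ 2) * R.faceStep.resolvent a (Pi.single u 1) (R.faceStep⁻¹ v) ^ 2 +
      (1 - a ^ 2) * R.faceStep.resolvent a (Pi.single u 1) v ^ 2) := by
  have h : R.stationaryState !![(a : ℂ), b; conj b, -a] (Pi.single u 1) =
      R.explicitState a b (Pi.single u 1) :=
    funext fun ε => (R.tendsto_stateAt_explicitState hab hb ha _ ε).limUnder_eq
  have hb2 : 1 - a ^ 2 = ‖b‖ ^ 2 := by rw [← hab]; ring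
  rw [comfortability, h, hb2]
  congr 1
  refine Finset.sum_congr rfl fun v _ => ?_
  have hg := norm_gauge u
  have hg' := norm_gauge v
  have e1 : ‖R.explicitState a b (Pi.single u 1) (.bridge v)‖ ^ 2 =
      (R.faceStep.resolvent a (Pi.single u 1) (R.faceStep⁻¹ (R.bar v)) -
        a * R.faceStep.resolvent a (Pi.single u 1) (R.faceStep⁻¹ v)) ^ 2 := by
    rw [explicitState, faceResolvent_single, faceResolvent_single, mul_left_comm (a : ℂ),
      ← mul_sub, ← Complex.ofReal_mul, ← Complex.ofReal_sub]
    simp [hg, hg', norm_twistSign, -Complex.ofReal_mul, -Complex.ofReal_sub]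
  rw [e1]
  simp [explicitState, faceResolvent_single, hg, hg', mul_pow]

theorem tendsto_sq_mul_comfortability [DecidableEq V] (C : ℝ → Matrix (Fin 2) (Fin 2) ℂ)
    (hC : ∀ δ ∈ Set.Ioo (0 : ℝ) 1, ∃ b : ℂ, b ≠ 0 ∧ (1 - δ) ^ 2 + ‖b‖ ^ 2 = 1 ∧
      (1 - δ) ^ orderOf R.faceStep ≠ 1 ∧
      C δ = !![((1 - δ : ℝ) : ℂ), b; conj b, -((1 - δ : ℝ) : ℂ)]) (u : CoverArc G) :
    Tendsto (fun δ : ℝ => δ ^ 2 * R.comfortability (C δ) (Pi.single u 1)) (𝓝[>] 0)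
      (𝓝 ((Face.length (R := R) (Quotient.mk R.faceSetoid u) : ℝ)⁻¹ *
        (1 - (Face.selfIntersection (R := R) (Quotient.mk R.faceSetoid u)).ncard /
          (Face.length (R := R) (Quotient.mk R.faceSetoid u) : ℝ)))) := by
  have hT := R.faceStep.tendsto_mul_resolvent u
  have hc : ∀ f : ℝ → ℝ, Continuous f → Tendsto f (𝓝[>] 0) (𝓝 (f 0)) := fun f hf =>
    (hf.tendsto 0).mono_left nhdsWithin_le_nhds
  have h1 := hc (fun δ => 1 - δ) (by fun_prop)
  have h2 := hc (fun δ => 1 - (1 - δ) ^ 2) (by fun_prop)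
  have key := (tendsto_finsetSum (Finset.univ : Finset (CoverArc G)) fun v _ =>
    ((((hT (R.faceStep⁻¹ (R.bar v))).sub (h1.mul (hT (R.faceStep⁻¹ v)))).pow 2).add
      (h2.mul ((hT (R.faceStep⁻¹ v)).pow 2))).add (h2.mul ((hT v).pow 2))).const_mul (1 / 2 : ℝ)
  -- In the limit the shifts by `faceStep⁻¹` are invisible and the quay terms drop out.
  simp only [Equiv.Perm.visitMean_inv_apply, sub_zero, one_mul, one_pow, sub_self, zero_mul,
    add_zero, R.sum_sq_visitMean_sub] at key
  rw [← mul_assoc, ← mul_assoc, one_div, inv_mul_cancel₀ two_ne_zero, one_mul] at key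
  refine key.congr' ?_
  filter_upwards [Ioo_mem_nhdsGT (zero_lt_one' ℝ)] with δ hδ
  obtain ⟨b, hb, hab, hN, hCδ⟩ := hC δ hδ
  rw [hCδ, R.comfortability_single hab hb hN, mul_left_comm, one_div, Finset.mul_sum (a := δ ^ 2)]
  congr 1
  exact Finset.sum_congr rfl fun v _ => by ring

end Limit

end RotationSystem

theorem corollary2p1 {V : Type*} [Fintype V] [DecidableEq V] [Nontrivial V]
    (G : SimpleGraph V) [DecidableRel G.Adj] (hG : G.Connected) (R : RotationSystem G)
    (C : ℝ → Matrix (Fin 2) (Fin 2) ℂ)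
    (hC : ∀ δ ∈ Set.Ioo (0 : ℝ) 1, C δ ∈ Matrix.unitaryGroup (Fin 2) ℂ ∧
      C δ 0 0 = ((1 - δ : ℝ) : ℂ) ∧ (C δ 1 1).im = 0 ∧ -(C δ).det = 1) :
    (∀ δ ∈ Set.Ioo (0 : ℝ) 1, ∀ (α : CoverArc G → ℂ) (ε : WalkArc G),
      Tendsto (fun t : ℕ => R.stateAt (C δ) α t ε) atTop
        (𝓝 (R.stationaryState (C δ) α ε))) ∧
    Tendsto (fun δ : ℝ => δ ^ 2 * R.meanComfortability (C δ)) (𝓝[>] 0)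
      (𝓝 ((Fintype.card R.Face : ℝ) / (2 * (G.edgeSet.ncard : ℝ)) *
        (1 - 1 / (Fintype.card R.Face : ℝ) *
          ∑ f : R.Face, (f.selfIntersection.ncard : ℝ) / (f.length : ℝ)))) := by
  have hcoin : ∀ δ ∈ Set.Ioo (0 : ℝ) 1, ∃ b : ℂ, b ≠ 0 ∧ (1 - δ) ^ 2 + ‖b‖ ^ 2 = 1 ∧
      (1 - δ) ^ orderOf R.faceStep ≠ 1 ∧
      C δ = !![((1 - δ : ℝ) : ℂ), b; conj b, -((1 - δ : ℝ) : ℂ)] := by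
    intro δ hδ
    obtain ⟨hu, ha, -, hdet⟩ := hC δ hδ
    obtain ⟨h1, h2⟩ := Matrix.eq_of_mem_unitaryGroup_of_det_eq_neg_one hu ha hdet
    refine ⟨C δ 0 1, fun h0 => ?_, h1, ?_, h2⟩
    · rw [h0, norm_zero] at h1
      nlinarith [hδ.1, hδ.2]
    · exact (pow_lt_one₀ (by linarith [hδ.2]) (by linarith [hδ.1])
        (orderOf_pos R.faceStep).ne').ne
  constructor
  · intro δ hδ α ε
    obtain ⟨b, hb, hab, hN, hCδ⟩ := hcoin δ hδ
    have h := R.tendsto_stateAt_explicitState hab hb hN α ε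
    rw [← hCδ] at h
    exact tendsto_nhds_limUnder ⟨_, h⟩
  · have key := (tendsto_finsetSum (Finset.univ : Finset (CoverArc G)) fun u _ =>
      R.tendsto_sq_mul_comfortability C hcoin u).const_mul
        (1 / (Fintype.card (CoverArc G) : ℝ))
    -- The weight `2|f|` of a face cancels the `1/|f|` in the limit for a single inflow.
    rw [R.sum_face_eq fun f => (f.length : ℝ)⁻¹ * (1 - f.selfIntersection.ncard / (f.length : ℝ))]
      at key
    have hl : ∀ f : R.Face, (f.length : ℝ) ≠ 0 := fun f => by
      induction f using Quotient.inductionOn with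
      | h u => exact_mod_cast (R.faceStep.minimalPeriod_pos u).ne'
    have hE : (G.edgeSet.ncard : ℝ) ≠ 0 := by
      obtain ⟨x⟩ := hG.nonempty
      obtain ⟨y, hy⟩ := hG.preconnected.exists_adj_of_nontrivial x
      exact_mod_cast ((Set.ncard_pos (Set.toFinite _)).2 ⟨s(x, y), hy⟩).ne'
    have hF : (Fintype.card R.Face : ℝ) ≠ 0 := by
      obtain ⟨x⟩ := hG.nonempty
      obtain ⟨y, hy⟩ := hG.preconnected.exists_adj_of_nontrivial x
      have : Nonempty R.Face := ⟨Quotient.mk R.faceSetoid (⟨(x, y), hy⟩, 0)⟩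
      exact_mod_cast Fintype.card_ne_zero
    have hsum : ∑ f : R.Face, 2 * (f.length : ℝ) *
        ((f.length : ℝ)⁻¹ * (1 - f.selfIntersection.ncard / (f.length : ℝ))) =
        2 * ((Fintype.card R.Face : ℝ) -
          ∑ f : R.Face, (f.selfIntersection.ncard : ℝ) / (f.length : ℝ)) := by
      have h1 : ∀ f : R.Face, 2 * (f.length : ℝ) *
          ((f.length : ℝ)⁻¹ * (1 - f.selfIntersection.ncard / (f.length : ℝ))) =
          2 * (1 - f.selfIntersection.ncard / (f.length : ℝ)) := fun f => by
        rw [mul_assoc, mul_inv_cancel_left₀ (hl f)]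
      rw [Finset.sum_congr rfl fun f _ => h1 f, ← Finset.mul_sum, Finset.sum_sub_distrib]
      simp
    rw [hsum, RotationSystem.card_coverArc] at key
    refine (key.congr fun δ => ?_).trans (le_of_eq ?_)
    · rw [RotationSystem.meanComfortability, ← RotationSystem.card_coverArc, ← Finset.mul_sum]
      ring
    · congr 1
      field_simp
      ring
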